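/- For a real ternary quadratic form $f$, let $\operatorname{Mat}(f)$ be its symmetric $3\times 3$ matrix and $\operatorname{Disc}(f)=\det\operatorname{Mat}(f)$, and let $[f=0]\subset\mathbb{RP}^2$ be its zero locus. When $f$ is non-degenerate and $[f=0]\neq\emptyset$, the *inside* of $[f=0]$ is the set of points of $\mathbb{RP}^2$ where $f$ has the sign of $\operatorname{Disc}(f)$ (it is the component of $\mathbb{RP}^2\setminus[f=0]$ homeomorphic to an open disk). We say that $[f=0]$ *lies inside* $[g=0]$ if $[f=0]$ is contained in the inside of $[g=0]$, and that the zero loci of $f$ and $g$ are *nested* if both are non-empty and one of them lies inside the other. The forms $f,g$ *generate a pencil in orbit Ia* if some invertible real linear change of the coordinates $x,y,z$ maps the linear span of $f$ and $g$ onto the span of $x^2+y^2+z^2$ and $xz$. Given $f,g$, write $$\phi(t)=\operatorname{Disc}(tf+g)=\Phi_{30}t^3+\Phi_{21}t^2+\Phi_{12}t+\Phi_{03},$$ and let $\psi(t)$ be the coefficient of $v$ in $\det\bigl(vI-\operatorname{Mat}(tf+g)\bigr)$. Put $$Q=\tfrac12\operatorname{Remainder}\bigl(\Phi_{30}\,\phi''\phi'\psi,\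 \phi\bigr)=q_2t^2+q_1t+q_0,$$ $$B_1=\begin{vmatrix}\Phi_{30}&\Phi_{21}&\Phi_{12}\\0&q_2&q_1\\q_2&q_1&q_0\end{vmatrix},\qquad R=\frac{\operatorname{Res}(\phi'',\phi)}{8\,\Phi_{30}},$$ where the remainder is that of the euclidean division by $\phi$ and $\operatorname{Res}(U,V)$ is the resultant, equal to $c^{\deg V}\prod_\rho V(\rho)$ with $c$ the leading coefficient of $U$ and $\rho$ running over the complex roots of $U$ with multiplicity. **Proposition.** Let $f,g$ be non-degenerate real ternary quadratic forms generating a pencil in orbit Ia, with nested zero loci. - If $\Phi_{03}R<0$, then $[f=0]$ lies inside $[g=0]$ if and only if $\Phi_{30}B_1>0$ and $\Phi_{03}q_2<0$. - If $\Phi_{03}R>0$, then $[f=0]$ lies inside $[g=0]$ if and only if $\Phi_{30}B_1\le 0$ or $\Phi_{03}q_2\le 0$. - If $R=0$, then $[f=0]$ lies inside $[g=0]$ if and only if $\Phi_{03}q_2<0$. -/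

import Mathlib

open Polynomial LinearAlgebra.Projectivization

noncomputable section

namespace PencilConics

/-- Real ternary quadratic forms. -/
abbrev TernaryForm : Type := QuadraticForm ℝ (Fin 3 → ℝ)

/-- The real projective plane. -/
abbrev RP2 : Type := ℙ ℝ (Fin 3 → ℝ)

/-- The discriminant of a form: the determinant of its symmetric matrix. -/
def disc (f : TernaryForm) : ℝ := f.toMatrix'.det

/-- The zero locus `[f = 0]` in the real projective plane.  The choice of the representative
vector is irrelevant, see `mem_zeroLocus_mk`. -/
def zeroLocus (f : TernaryForm) : Set RP2 := {p | f p.rep = 0}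

/-- The inside of a proper non-empty conic `[f = 0]`: the set of the points where `f` takes the
sign of its discriminant.  For a non-degenerate `f` with non-empty zero locus this is the connected
component of the complement of `[f = 0]` that is an open disk. The choice of the representative
vector is irrelevant, see `mem_inside_mk`. -/
def inside (f : TernaryForm) : Set RP2 :=
  {p | SignType.sign (f p.rep) = SignType.sign (disc f)}

theorem mem_zeroLocus_mk (f : TernaryForm) (v : Fin 3 → ℝ) (hv : v ≠ 0) :
    Projectivization.mk ℝ v hv ∈ zeroLocus f ↔ f v = 0 := by
  obtain ⟨a, ha⟩ := Projectivization.exists_smul_eq_mk_rep ℝ v hv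
  have h : f (Projectivization.mk ℝ v hv).rep = (a : ℝ) * a * f v := by
    rw [← ha, Units.smul_def, QuadraticMap.map_smul, smul_eq_mul]
  simp [zeroLocus, h]

theorem mem_inside_mk (f : TernaryForm) (v : Fin 3 → ℝ) (hv : v ≠ 0) :
    Projectivization.mk ℝ v hv ∈ inside f ↔
      SignType.sign (f v) = SignType.sign (disc f) := by
  obtain ⟨a, ha⟩ := Projectivization.exists_smul_eq_mk_rep ℝ v hv
  have h : f (Projectivization.mk ℝ v hv).rep = (a : ℝ) * a * f v := by
    rw [← ha, Units.smul_def, QuadraticMap.map_smul, smul_eq_mul]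
  have h2 : SignType.sign ((a : ℝ) * a) = 1 :=
    sign_pos (mul_self_pos.mpr a.ne_zero)
  simp [inside, h, sign_mul, h2] 

/-- The conic `[f = 0]` lies inside the conic `[g = 0]`. -/
def LiesInside (f g : TernaryForm) : Prop := zeroLocus f ⊆ inside g

/-- The zero loci of `f` and `g` are non-empty, and one of them lies inside the other. -/
def Nested (f g : TernaryForm) : Prop :=
  (zeroLocus f).Nonempty ∧ (zeroLocus g).Nonempty ∧ (LiesInside f g ∨ LiesInside g f)

/-- The quadratic form `(x₀, x₁, x₂) ↦ xᵢ xⱼ`. -/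
def monomialForm (i j : Fin 3) : TernaryForm :=
  QuadraticMap.linMulLin (LinearMap.proj i) (LinearMap.proj j)

/-- The pencil of quadratic forms generated by `f` and `g`. -/
def pencil (f g : TernaryForm) : Submodule ℝ TernaryForm := Submodule.span ℝ {f, g}

/-- The pencil generated by `f` and `g` is in the orbit Ia: some linear change of coordinates maps
it onto the pencil generated by `x² + y² + z²` and `xz`.  (The latter is a plane, so `f` and `g` are
then not proportional.) -/
def GeneratesOrbitIa (f g : TernaryForm) : Prop :=
  ∃ e : (Fin 3 → ℝ) ≃ₗ[ℝ] (Fin 3 → ℝ),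
    pencil (f.comp e.toLinearMap) (g.comp e.toLinearMap) =
      pencil (monomialForm 0 0 + monomialForm 1 1 + monomialForm 2 2) (monomialForm 0 2)

/-- The matrix of `t f + g`, with entries in `ℝ[t]`. -/
def pencilMatrix (f g : TernaryForm) : Matrix (Fin 3) (Fin 3) ℝ[X] :=
  (X : ℝ[X]) • f.toMatrix'.map C + g.toMatrix'.map C

/-- `φ(t) = Disc (t f + g)`. -/
def phi (f g : TernaryForm) : ℝ[X] := (pencilMatrix f g).det

/-- `ψ(t)`, the coefficient of `v` in `det (v I - Matrix (t f + g))`. -/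
def psi (f g : TernaryForm) : ℝ[X] := (pencilMatrix f g).charpoly.coeff 1

/-- `Φ₃₀`, the coefficient of `t³` in `φ`. -/
def Phi30 (f g : TernaryForm) : ℝ := (phi f g).coeff 3

/-- `Φ₀₃`, the constant coefficient of `φ`. -/
def Phi03 (f g : TernaryForm) : ℝ := (phi f g).coeff 0

/-- `Q`, half of the remainder in the euclidean division of `Φ₃₀ φ'' φ' ψ` by `φ`. -/
def Q (f g : TernaryForm) : ℝ[X] :=
  C (1 / 2) * ((C (Phi30 f g) * derivative (derivative (phi f g)) * derivative (phi f g)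
    * psi f g) % phi f g)

/-- `q₂`, the coefficient of `t²` in `Q`. -/
def q2 (f g : TernaryForm) : ℝ := (Q f g).coeff 2

/-- The signed subresultant principal coefficient of index `1` of a polynomial `V` of degree `3`
and a polynomial `W` of degree at most `2`. -/
def sr1 (V W : ℝ[X]) : ℝ :=
  !![V.coeff 3, V.coeff 2, V.coeff 1;
     0,         W.coeff 2, W.coeff 1;
     W.coeff 2, W.coeff 1, W.coeff 0].det

/-- `B₁`, the signed subresultant principal coefficient of index `1` of `φ` and `Q`. -/
def B1 (f g : TernaryForm) : ℝ := sr1 (phi f g) (Q f g)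

/-- `R = Res (φ'', φ) / (8 Φ₃₀)`. -/
def R (f g : TernaryForm) : ℝ :=
  (derivative (derivative (phi f g))).resultant (phi f g) / (8 * Phi30 f g)

end PencilConics

end

/-! ### Forms in diagonal coordinates -/

noncomputable section

namespace PencilConics

open Matrix

/-! A pencil in orbit Ia is simultaneously diagonalizable, `f = ∑ aᵢ Xᵢ²` and `g = ∑ bᵢ Xᵢ²`, so `φ`
has the distinct real roots `-bᵢ/aᵢ`. Nestedness forces `a` and `b` to have the same odd coordinate
(the one whose sign differs from the other two) and the roots to have the same sign. The root of the
odd coordinate is then the largest in absolute value if `[f=0]` lies inside `[g=0]`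
(`exists_isOrdered`), and the smallest in the opposite case.

The invariants detect this position. Let `x, y, z` be the roots, in decreasing absolute value.
Writing `Q` in Lagrange form, with weights `u, v, w` at the roots, `q₂ = u + v + w` and `Φ₃₀ B₁` is
a positive multiple of the determinant of the `2 × 2` moment matrix of these weights (`Q_cubic`).
Thus the two conditions are about the definiteness of that matrix. The value of `ψ` at a root is, up
to a positive factor, a product of two `aᵢ` and of two root differences, so after multiplication by
`Φ₀₃` the signs are known (`exists_weights`): `u` and `w` are both negative if `[f=0]` lies inside,
both positive if `[g=0]` does, while `v` has the sign of `Φ₀₃ R` in both cases.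

If `v` agrees in sign with `u` and `w`, the matrix is definite of that sign. If not, it cannot be
definite of the sign of `v`, since the second moment centred at `y` does not involve `v`
(`minor_identity`). These facts separate the two cases. -/

/-- A simultaneous diagonalization of two forms: in the coordinates given by the rows of the
invertible matrix `P`, the forms are `∑ aᵢ xᵢ²` and `∑ bᵢ xᵢ²`, and the points `[aᵢ : bᵢ]` are
pairwise distinct. -/
structure IsDiagonalization (f g : TernaryForm) (P : Matrix (Fin 3) (Fin 3) ℝ)
    (a b : Fin 3 → ℝ) : Prop where
  det_ne : P.det ≠ 0
  left : f.toMatrix' = Pᵀ * diagonal a * P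
  right : g.toMatrix' = Pᵀ * diagonal b * P
  ne : ∀ i j, i ≠ j → a i * b j ≠ a j * b i

theorem apply_eq_of_toMatrix' {f : TernaryForm} {P : Matrix (Fin 3) (Fin 3) ℝ} {a : Fin 3 → ℝ}
    (h : f.toMatrix' = Pᵀ * diagonal a * P) (v : Fin 3 → ℝ) :
    f v = ∑ i, a i * (P *ᵥ v) i ^ 2 := by
  have h1 : f v = v ⬝ᵥ f.toMatrix' *ᵥ v := by
    rw [QuadraticForm.toMatrix', ← Matrix.toLinearMap₂'_apply' (T := ℝ),
      Matrix.toLinearMap₂'_toMatrix', QuadraticMap.associated_eq_self_apply]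
  rw [h1, h]
  simp [Matrix.mul_apply, mulVec, dotProduct, Fin.sum_univ_three, diagonal]
  ring

theorem disc_eq_of_toMatrix' {f : TernaryForm} {P : Matrix (Fin 3) (Fin 3) ℝ} {a : Fin 3 → ℝ}
    (h : f.toMatrix' = Pᵀ * diagonal a * P) :
    disc f = P.det ^ 2 * (a 0 * a 1 * a 2) := by
  rw [disc, h, det_mul, det_mul, det_transpose, det_diagonal, Fin.prod_univ_three]
  ring

namespace IsDiagonalization

variable {f g : TernaryForm} {P : Matrix (Fin 3) (Fin 3) ℝ} {a b : Fin 3 → ℝ}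

theorem swap (h : IsDiagonalization f g P a b) : IsDiagonalization g f P b a where
  det_ne := h.det_ne
  left := h.right
  right := h.left
  ne i j hij := by rw [mul_comm, mul_comm (b j)]; exact h.ne j i hij.symm

theorem perm (h : IsDiagonalization f g P a b) (σ : Equiv.Perm (Fin 3)) :
    IsDiagonalization f g (P.submatrix σ id) (a ∘ σ) (b ∘ σ) where
  det_ne := by
    rw [det_permute]
    exact mul_ne_zero (by simp) h.det_ne
  left := by
    rw [h.left, ← submatrix_diagonal_equiv, transpose_submatrix, submatrix_mul_equiv,
      submatrix_mul_equiv, submatrix_id_id]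
  right := by
    rw [h.right, ← submatrix_diagonal_equiv, transpose_submatrix, submatrix_mul_equiv,
      submatrix_mul_equiv, submatrix_id_id]
  ne i j hij := h.ne _ _ (σ.injective.ne hij)

theorem surjective_mulVec (h : IsDiagonalization f g P a b) (x : Fin 3 → ℝ) :
    ∃ v, P *ᵥ v = x := by
  refine ⟨P⁻¹ *ᵥ x, ?_⟩
  rw [mulVec_mulVec, mul_nonsing_inv _ (isUnit_iff_ne_zero.2 h.det_ne), one_mulVec]

end IsDiagonalization

/-! ### Diagonalizing a pencil in orbit Ia -/

/-- The matrix of the change of coordinates `(X, Y, Z) ↦ (X + Z, Y, X - Z)`, which diagonalizes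
`x² + y² + z²` and `xz` simultaneously. -/
def rotation : Matrix (Fin 3) (Fin 3) ℝ := !![1, 0, 1; 0, 1, 0; 1, 0, -1]

theorem monomialForm_toMatrix' (i j : Fin 3) :
    (monomialForm i j).toMatrix' =
      of fun k l ↦ ((if i = k ∧ j = l then 1 else 0) + (if i = l ∧ j = k then 1 else 0) : ℝ) / 2 := by
  ext k l
  rw [QuadraticForm.toMatrix', LinearMap.toMatrix₂'_apply, QuadraticMap.associated_apply]
  fin_cases i <;> fin_cases j <;> fin_cases k <;> fin_cases l <;>
    simp [monomialForm] <;> norm_num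

theorem toMatrix'_add (f g : TernaryForm) :
    (f + g).toMatrix' = f.toMatrix' + g.toMatrix' := by
  simp [QuadraticForm.toMatrix']

theorem transpose_rotation_mul (s u : ℝ) :
    rotationᵀ * (s • (monomialForm 0 0 + monomialForm 1 1 + monomialForm 2 2)
      + u • monomialForm 0 2 : TernaryForm).toMatrix' * rotation =
      diagonal ![2 * s + u, s, 2 * s - u] := by
  simp only [toMatrix'_add, QuadraticForm.toMatrix'_smul, monomialForm_toMatrix']
  ext i j
  fin_cases i <;> fin_cases j <;>
    simp [rotation, Matrix.mul_apply, Fin.sum_univ_three] <;> ring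

theorem det_rotation : rotation.det = -2 := by
  simp [rotation, det_fin_three]; norm_num

theorem GeneratesOrbitIa.exists_isDiagonalization {f g : TernaryForm}
    (h : GeneratesOrbitIa f g) : ∃ P a b, IsDiagonalization f g P a b := by
  obtain ⟨e, he⟩ := h
  set q₁ : TernaryForm := monomialForm 0 0 + monomialForm 1 1 + monomialForm 2 2 with hq₁
  set q₂ : TernaryForm := monomialForm 0 2 with hq₂
  have hf : f.comp e.toLinearMap ∈ pencil q₁ q₂ :=
    he ▸ Submodule.subset_span (by simp)
  have hg : g.comp e.toLinearMap ∈ pencil q₁ q₂ :=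
    he ▸ Submodule.subset_span (by simp)
  have h1 : q₁ ∈ pencil (f.comp e.toLinearMap) (g.comp e.toLinearMap) :=
    he ▸ Submodule.subset_span (by simp)
  have h2 : q₂ ∈ pencil (f.comp e.toLinearMap) (g.comp e.toLinearMap) :=
    he ▸ Submodule.subset_span (by simp)
  obtain ⟨s, u, hf⟩ := Submodule.mem_span_pair.1 hf
  obtain ⟨s', u', hg⟩ := Submodule.mem_span_pair.1 hg
  obtain ⟨α, β, h1⟩ := Submodule.mem_span_pair.1 h1
  obtain ⟨γ, δ, h2⟩ := Submodule.mem_span_pair.1 h2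
  have hdet : s * u' - s' * u ≠ 0 := by
    rw [← hf, ← hg] at h1 h2
    -- On `q₁` and `q₂` the point `(0,1,0)` takes the values `1, 0` and `(1,0,1)` the values `2, 1`,
    -- so evaluating there recovers coordinates in the pencil.
    have e1 := congrArg (fun q : TernaryForm ↦ q ![0, 1, 0]) h1
    have e2 := congrArg (fun q : TernaryForm ↦ q ![1, 0, 1]) h1
    have e3 := congrArg (fun q : TernaryForm ↦ q ![0, 1, 0]) h2
    have e4 := congrArg (fun q : TernaryForm ↦ q ![1, 0, 1]) h2
    simp [hq₁, hq₂, monomialForm] at e1 e2 e3 e4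
    intro h0
    have : (α * s + β * s') * (γ * u + δ * u') - (γ * s + δ * s') * (α * u + β * u')
      = (α * δ - β * γ) * (s * u' - s' * u) := by ring
    have k2 : α * u + β * u' = 0 := by linarith
    have k4 : γ * u + δ * u' = 1 := by linarith
    rw [h0, e1, e3, k2, k4] at this
    norm_num at this
  set E : Matrix (Fin 3) (Fin 3) ℝ := LinearMap.toMatrix' e.symm.toLinearMap with hE
  have hEdet : E.det ≠ 0 := by
    rw [hE, LinearMap.det_toMatrix']
    exact (LinearEquiv.isUnit_det' e.symm).ne_zero
  have hrot : IsUnit rotation.det := by rw [det_rotation]; norm_num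
  have key : ∀ (q : TernaryForm) (s u : ℝ), s • q₁ + u • q₂ = q.comp e.toLinearMap →
      q.toMatrix' = (rotation⁻¹ * E)ᵀ * diagonal ![2 * s + u, s, 2 * s - u] * (rotation⁻¹ * E) := by
    intro q s u hq
    have hq' : q = (s • q₁ + u • q₂).comp e.symm.toLinearMap := by
      rw [hq]; ext v; simp
    rw [← transpose_rotation_mul, hq', QuadraticForm.toMatrix'_comp, ← hE, transpose_mul]
    have : rotation * (rotation⁻¹ * E) = E := by
      rw [← Matrix.mul_assoc, mul_nonsing_inv _ hrot, Matrix.one_mul]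
    have h' : Eᵀ * (rotation⁻¹)ᵀ * rotationᵀ = Eᵀ := by
      rw [Matrix.mul_assoc, ← transpose_mul, mul_nonsing_inv _ hrot, transpose_one, Matrix.mul_one]
    calc _ = (Eᵀ * (rotation⁻¹)ᵀ * rotationᵀ) * (s • q₁ + u • q₂).toMatrix' *
          (rotation * (rotation⁻¹ * E)) := by rw [this, h']
      _ = _ := by simp only [Matrix.mul_assoc]; rfl
  refine ⟨rotation⁻¹ * E, ![2 * s + u, s, 2 * s - u], ![2 * s' + u', s', 2 * s' - u'],
    ?_, key f s u hf, key g s' u' hg, ?_⟩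
  · rw [det_mul]
    exact mul_ne_zero (by simp [det_nonsing_inv, det_rotation]) hEdet
  · intro i j hij h
    -- Every `2 × 2` minor of the two diagonals is a nonzero multiple of `s * u' - s' * u`.
    apply hdet
    fin_cases i <;> fin_cases j <;> simp at hij h <;> linarith

theorem IsDiagonalization.sign_of_liesInside {f g : TernaryForm} {P : Matrix (Fin 3) (Fin 3) ℝ}
    {a b : Fin 3 → ℝ} (h : IsDiagonalization f g P a b) (hfg : LiesInside f g)
    (x : Fin 3 → ℝ) (hx : x ≠ 0) (h0 : ∑ i, a i * x i ^ 2 = 0) :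
    SignType.sign (∑ i, b i * x i ^ 2) = SignType.sign (b 0 * b 1 * b 2) := by
  obtain ⟨v, rfl⟩ := h.surjective_mulVec x
  have hv : v ≠ 0 := by rintro rfl; simp at hx
  rw [← apply_eq_of_toMatrix' h.left] at h0
  have := hfg ((mem_zeroLocus_mk f v hv).2 h0)
  rw [mem_inside_mk, disc_eq_of_toMatrix' h.right, apply_eq_of_toMatrix' h.right, sign_mul,
    sign_pos (sq_pos_of_ne_zero h.det_ne), one_mul] at this
  exact this

/-! ### `φ` and `ψ` in diagonal coordinates -/

theorem charpoly_coeff_one_fin_three {S : Type*} [CommRing S] [Nontrivial S]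
    (M : Matrix (Fin 3) (Fin 3) S) :
    M.charpoly.coeff 1 = (M 0 0 * M 1 1 - M 0 1 * M 1 0) + (M 0 0 * M 2 2 - M 0 2 * M 2 0) +
      (M 1 1 * M 2 2 - M 1 2 * M 2 1) := by
  have h : M.charpoly = X ^ 3 - C (M 0 0 + M 1 1 + M 2 2) * X ^ 2
      + C ((M 0 0 * M 1 1 - M 0 1 * M 1 0) + (M 0 0 * M 2 2 - M 0 2 * M 2 0) +
      (M 1 1 * M 2 2 - M 1 2 * M 2 1)) * X - C M.det := by
    simp only [charpoly, charmatrix, det_fin_three]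
    simp
    ring
  rw [h]
  simp only [coeff_add, coeff_sub, coeff_C_mul, coeff_X_pow, coeff_X, coeff_C]
  simp

/-- The sum of the squares of the cofactors of the `k`-th row of a matrix. -/
def cofactorNorm (P : Matrix (Fin 3) (Fin 3) ℝ) (k : Fin 3) : ℝ := ∑ j, P.adjugate j k ^ 2

theorem cofactorNorm_pos {P : Matrix (Fin 3) (Fin 3) ℝ} (hP : P.det ≠ 0) (k : Fin 3) :
    0 < cofactorNorm P k := by
  refine lt_of_le_of_ne (Finset.sum_nonneg fun _ _ ↦ sq_nonneg _) fun h ↦ hP ?_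
  have h0 := (Finset.sum_eq_zero_iff_of_nonneg fun _ _ ↦ sq_nonneg _).1 h.symm
  have := congrFun (congrFun (mul_adjugate P) k) k
  rw [Matrix.mul_apply, Finset.sum_eq_zero] at this
  · simpa using this.symm
  · intro j hj
    rw [pow_eq_zero_iff two_ne_zero |>.1 (h0 j hj), mul_zero]

/-- This coefficient is the trace of the adjugate, and `adj (Pᵀ D P) = adj P * adj D * (adj P)ᵀ`. At
a root of `φ` two of the three terms vanish, which gives the sign of `ψ` there. -/
theorem charpoly_coeff_one_conj_diagonal (P : Matrix (Fin 3) (Fin 3) ℝ) (d : Fin 3 → ℝ) :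
    (Pᵀ * diagonal d * P).charpoly.coeff 1 = cofactorNorm P 0 * (d 1 * d 2) +
      cofactorNorm P 1 * (d 0 * d 2) + cofactorNorm P 2 * (d 0 * d 1) := by
  rw [charpoly_coeff_one_fin_three]
  simp only [cofactorNorm, adjugate_fin_three, Fin.sum_univ_three, Matrix.mul_apply, diagonal]
  simp
  ring

namespace IsDiagonalization

variable {f g : TernaryForm} {P : Matrix (Fin 3) (Fin 3) ℝ} {a b : Fin 3 → ℝ}

theorem pencilMatrix_map_eval (h : IsDiagonalization f g P a b) (t : ℝ) :
    (pencilMatrix f g).map (evalRingHom t) = Pᵀ * diagonal (t • a + b) * P := by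
  have : diagonal (t • a + b) = t • diagonal a + diagonal b := by
    rw [← diagonal_smul, diagonal_add]; rfl
  rw [this, Matrix.mul_add, Matrix.add_mul, Matrix.mul_smul, Matrix.smul_mul, ← h.left, ← h.right]
  ext i j
  simp [pencilMatrix]
  exact mul_comm _ _

theorem eval_psi (h : IsDiagonalization f g P a b) (t : ℝ) :
    (psi f g).eval t = cofactorNorm P 0 * ((t * a 1 + b 1) * (t * a 2 + b 2)) +
      cofactorNorm P 1 * ((t * a 0 + b 0) * (t * a 2 + b 2)) +
      cofactorNorm P 2 * ((t * a 0 + b 0) * (t * a 1 + b 1)) := by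
  have := charpoly_coeff_one_conj_diagonal P (t • a + b)
  rw [← h.pencilMatrix_map_eval t, charpoly_map, coeff_map] at this
  simpa [psi] using this

theorem phi_eq (h : IsDiagonalization f g P a b) :
    phi f g = C (P.det ^ 2) * ((C (a 0) * X + C (b 0)) * (C (a 1) * X + C (b 1)) *
      (C (a 2) * X + C (b 2))) := by
  refine Polynomial.funext fun t ↦ ?_
  have := congrArg det (h.pencilMatrix_map_eval t)
  rw [← RingHom.mapMatrix_apply, ← RingHom.map_det, det_mul, det_mul, det_transpose,
    det_diagonal, Fin.prod_univ_three] at this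
  simp only [coe_evalRingHom] at this
  rw [phi, this]
  simp
  ring

end IsDiagonalization

/-! ### `R`, `q₂` and `B₁` through the roots of `φ` -/

/-- A quadratic polynomial in Lagrange form: its coefficients in terms of the barycentric
weights. -/
theorem coeff_eq_of_lagrange {x y z q₀ q₁ q₂ u v w : ℝ} (hxy : x ≠ y) (hxz : x ≠ z) (hyz : y ≠ z)
    (hx : q₂ * x ^ 2 + q₁ * x + q₀ = u * ((x - y) * (x - z)))
    (hy : q₂ * y ^ 2 + q₁ * y + q₀ = v * ((y - x) * (y - z)))
    (hz : q₂ * z ^ 2 + q₁ * z + q₀ = w * ((z - x) * (z - y))) :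
    q₂ = u + v + w ∧ q₁ = -(u * (y + z) + v * (x + z) + w * (x + y)) ∧
      q₀ = u * (y * z) + v * (x * z) + w * (x * y) := by
  have e2 : q₂ = u + v + w := by
    have : (q₂ - (u + v + w)) * ((x - y) * (x - z) * (y - z)) = 0 := by
      linear_combination (y - z) * hx - (x - z) * hy + (x - y) * hz
    have h0 : (x - y) * (x - z) * (y - z) ≠ 0 :=
      mul_ne_zero (mul_ne_zero (sub_ne_zero.2 hxy) (sub_ne_zero.2 hxz)) (sub_ne_zero.2 hyz)
    linarith [(mul_eq_zero.1 this).resolve_right h0]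
  have e1 : q₁ = -(u * (y + z) + v * (x + z) + w * (x + y)) := by
    have : (q₁ + (u * (y + z) + v * (x + z) + w * (x + y))) * (x - y) = 0 := by
      rw [e2] at hx hy
      linear_combination hx - hy
    linarith [(mul_eq_zero.1 this).resolve_right (sub_ne_zero.2 hxy)]
  refine ⟨e2, e1, ?_⟩
  rw [e2, e1] at hx
  linear_combination hx

section Cubic

variable {f g : TernaryForm} {c x y z : ℝ}

theorem derivative_cubic (h : phi f g = C c * ((X - C x) * (X - C y) * (X - C z))) :
    derivative (phi f g) = C c * ((X - C x) * (X - C y) + (X - C x) * (X - C z)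
      + (X - C y) * (X - C z)) := by
  rw [h]; simp [derivative_mul]; left; ring

theorem derivative_derivative_cubic
    (h : phi f g = C c * ((X - C x) * (X - C y) * (X - C z))) :
    derivative (derivative (phi f g)) = C (6 * c) * (X - C ((x + y + z) / 3)) := by
  have h3 : (C (3 : ℝ)) = 3 := rfl
  have : C ((x + y + z) / 3) * 3 = C x + C y + C z := by
    rw [← h3, ← C_mul, ← C_add, ← C_add]; congr 1; ring
  have h6 : (C (6 : ℝ)) = 6 := rfl
  rw [derivative_cubic h, C_mul, h6, mul_sub, mul_sub]
  simp [derivative_mul]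
  linear_combination (2 * C c) * this

theorem coeff_cubic (h : phi f g = C c * ((X - C x) * (X - C y) * (X - C z))) :
    (phi f g).coeff 3 = c ∧ (phi f g).coeff 2 = -c * (x + y + z) ∧
      (phi f g).coeff 1 = c * (x * y + x * z + y * z) ∧ (phi f g).coeff 0 = -c * (x * y * z) := by
  have : phi f g = C c * X ^ 3 + C (-c * (x + y + z)) * X ^ 2 + C (c * (x * y + x * z + y * z)) * X
      + C (-c * (x * y * z)) := by
    rw [h]; simp; ring
  rw [this]
  simp only [coeff_add, coeff_C_mul, coeff_X_pow, coeff_X, coeff_C]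
  simp

theorem natDegree_cubic (hc : c ≠ 0) (h : phi f g = C c * ((X - C x) * (X - C y) * (X - C z))) :
    (phi f g).natDegree = 3 := by
  rw [h]; compute_degree!

/-- The only root of `φ''` is the mean of the roots of `φ`, so the resultant is `(6c)³` times the
value of `φ` at that mean. -/
theorem R_cubic (hc : c ≠ 0) (h : phi f g = C c * ((X - C x) * (X - C y) * (X - C z))) :
    R f g = -c ^ 3 * ((3 * x - (x + y + z)) * (3 * y - (x + y + z)) * (3 * z - (x + y + z))) := by
  have hd : (derivative (derivative (phi f g))).natDegree = 1 := by
    rw [derivative_derivative_cubic h, natDegree_C_mul (by simpa using hc), natDegree_X_sub_C]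
  rw [R, hd, natDegree_cubic hc h, derivative_derivative_cubic h, resultant_C_mul_left,
    resultant_X_sub_C_left _ _ _ (natDegree_cubic hc h).le, Phi30, (coeff_cubic h).1, h]
  simp
  field_simp
  ring

/-- Reduction modulo `φ` does not change values at its roots. There `φ'` supplies the Lagrange
factor, such as `(x - y) * (x - z)`, and the rest is the weight. -/
theorem Q_cubic (hc : c ≠ 0) (hxy : x ≠ y) (hxz : x ≠ z) (hyz : y ≠ z)
    (h : phi f g = C c * ((X - C x) * (X - C y) * (X - C z))) {u v w : ℝ}
    (hu : u = c ^ 3 * (3 * x - (x + y + z)) * (psi f g).eval x)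
    (hv : v = c ^ 3 * (3 * y - (x + y + z)) * (psi f g).eval y)
    (hw : w = c ^ 3 * (3 * z - (x + y + z)) * (psi f g).eval z) :
    q2 f g = u + v + w ∧ Phi30 f g * B1 f g = c ^ 2 *
      (u * v * (x - y) ^ 2 + u * w * (x - z) ^ 2 + v * w * (y - z) ^ 2) := by
  have h0 : phi f g ≠ 0 := by
    intro h0; have := natDegree_cubic hc h; simp [h0] at this
  have hdeg : (Q f g).natDegree ≤ 2 := by
    refine (natDegree_C_mul_le _ _).trans ?_
    have := natDegree_mod_lt (C (Phi30 f g) * derivative (derivative (phi f g)) *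
      derivative (phi f g) * psi f g) (q := phi f g) (by rw [natDegree_cubic hc h]; norm_num)
    rw [natDegree_cubic hc h] at this
    omega
  have hQ : ∀ t, (Q f g).eval t =
      (Q f g).coeff 2 * t ^ 2 + (Q f g).coeff 1 * t + (Q f g).coeff 0 := by
    intro t
    rw [eval_eq_sum_range' (n := 3) (by omega)]
    simp [Finset.sum_range_succ]; ring
  have hQt : ∀ t, (phi f g).eval t = 0 → (Q f g).eval t = c ^ 3 * (3 * t - (x + y + z)) *
      (psi f g).eval t * ((t - x) * (t - y) + (t - x) * (t - z) + (t - y) * (t - z)) := by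
    intro t ht
    rw [Q, eval_mul, eval_C, EuclideanDomain.mod_eq_sub_mul_div, eval_sub, eval_mul (p := phi f g),
      ht, derivative_derivative_cubic h, derivative_cubic h, Phi30, (coeff_cubic h).1]
    simp
    ring
  obtain ⟨e2, e1, e0⟩ := coeff_eq_of_lagrange hxy hxz hyz (q₂ := (Q f g).coeff 2)
    (q₁ := (Q f g).coeff 1) (q₀ := (Q f g).coeff 0) (u := u) (v := v) (w := w)
    (by rw [← hQ, hQt x (by simp [h]), hu]; ring)
    (by rw [← hQ, hQt y (by simp [h]), hv]; ring)
    (by rw [← hQ, hQt z (by simp [h]), hw]; ring)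
  refine ⟨e2, ?_⟩
  obtain ⟨c3, c2, c1, -⟩ := coeff_cubic h
  rw [Phi30, B1, sr1, e2, e1, e0, c3, c2, c1]
  simp [det_fin_three]
  ring

end Cubic

/-! ### Sign patterns of nested conics -/

namespace IsDiagonalization

variable {f g : TernaryForm} {P : Matrix (Fin 3) (Fin 3) ℝ} {a b : Fin 3 → ℝ}

theorem not_definite (h : IsDiagonalization f g P a b) (hf : (zeroLocus f).Nonempty) :
    ¬ (0 < a 0 * a 1 ∧ 0 < a 0 * a 2) := by
  rintro ⟨h1, h2⟩
  obtain ⟨p, hp⟩ := hf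
  have hp' : f p.rep = 0 := hp
  rw [apply_eq_of_toMatrix' h.left, Fin.sum_univ_three] at hp'
  have h0 : 0 < a 0 * a 0 := mul_self_pos.2 fun h0 ↦ by simp [h0] at h1
  have hsum : a 0 * a 0 * (P *ᵥ p.rep) 0 ^ 2 + a 0 * a 1 * (P *ᵥ p.rep) 1 ^ 2
      + a 0 * a 2 * (P *ᵥ p.rep) 2 ^ 2 = 0 := by linear_combination a 0 * hp'
  have k0 := mul_nonneg h0.le (sq_nonneg ((P *ᵥ p.rep) 0))
  have k1 := mul_nonneg h1.le (sq_nonneg ((P *ᵥ p.rep) 1))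
  have k2 := mul_nonneg h2.le (sq_nonneg ((P *ᵥ p.rep) 2))
  have e0 : (P *ᵥ p.rep) 0 = 0 := by
    simpa [h0.ne'] using (show a 0 * a 0 * (P *ᵥ p.rep) 0 ^ 2 = 0 by linarith)
  have e1 : (P *ᵥ p.rep) 1 = 0 := by
    simpa [left_ne_zero_of_mul h1.ne', right_ne_zero_of_mul h1.ne'] using
      (show a 0 * a 1 * (P *ᵥ p.rep) 1 ^ 2 = 0 by linarith)
  have e2 : (P *ᵥ p.rep) 2 = 0 := by
    simpa [left_ne_zero_of_mul h2.ne', right_ne_zero_of_mul h2.ne'] using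
      (show a 0 * a 2 * (P *ᵥ p.rep) 2 ^ 2 = 0 by linarith)
  refine p.rep_nonzero (eq_zero_of_mulVec_eq_zero h.det_ne (funext fun i ↦ ?_))
  fin_cases i
  exacts [e0, e1, e2]

/-- Since `a i` and `a j` have opposite signs, the point with `xᵢ² = |a j|`, `xⱼ² = |a i|` and third
coordinate zero is on `[f=0]`; there `g` must have the sign of its discriminant. -/
theorem pos_of_liesInside (h : IsDiagonalization f g P a b) (hg : b 0 * b 1 * b 2 ≠ 0)
    (hfg : LiesInside f g) {i j : Fin 3} (hij : i ≠ j) (ha : a i * a j < 0) :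
    0 < a i * (b j * a i - b i * a j) * (b 0 * b 1 * b 2) := by
  have hi : a i ≠ 0 := left_ne_zero_of_mul ha.ne
  have hsum : ∀ c : Fin 3 → ℝ, ∑ k, c k * (Pi.single i √|a j| + Pi.single j √|a i| :
      Fin 3 → ℝ) k ^ 2 = c i * |a j| + c j * |a i| := by
    intro c
    have : ∀ k, c k * (Pi.single i √|a j| + Pi.single j √|a i| : Fin 3 → ℝ) k ^ 2
        = (if k = i then c i * |a j| else 0) + (if k = j then c j * |a i| else 0) := by
      intro k
      by_cases hki : k = i
      · subst hki; simp [hij]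
      · by_cases hkj : k = j
        · subst hkj; simp [hij.symm]
        · simp [hki, hkj]
    rw [Finset.sum_congr rfl fun k _ ↦ this k, Finset.sum_add_distrib]
    simp
  have hs := h.sign_of_liesInside hfg (Pi.single i √|a j| + Pi.single j √|a i|) ?_ ?_
  · rw [hsum] at hs
    have hpos : 0 < (b i * |a j| + b j * |a i|) * (b 0 * b 1 * b 2) := by
      rw [← sign_eq_one_iff, sign_mul, hs, ← sign_mul, sign_eq_one_iff]
      exact mul_self_pos.2 hg
    rcases lt_or_gt_of_ne hi with h0 | h0
    · have h1 : 0 < a j := by nlinarith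
      rw [abs_of_neg h0, abs_of_pos h1] at hpos
      nlinarith
    · have h1 : a j < 0 := by nlinarith
      rw [abs_of_pos h0, abs_of_neg h1] at hpos
      nlinarith
  · intro h0
    have := congrFun h0 j
    simp [hij.symm] at this
    exact hi this
  · rw [hsum]
    rcases lt_or_gt_of_ne hi with h0 | h0
    · have h1 : 0 < a j := by nlinarith
      rw [abs_of_neg h0, abs_of_pos h1]; ring
    · have h1 : a j < 0 := by nlinarith
      rw [abs_of_pos h0, abs_of_neg h1]; ring

end IsDiagonalization

/-- The first coordinate is distinguished in the signatures of `∑ aᵢ xᵢ²` and of `∑ bᵢ xᵢ²`, and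
the ratios `bᵢ / aᵢ` decrease in absolute value. -/
structure IsOrdered (a b : Fin 3 → ℝ) : Prop where
  a01 : a 0 * a 1 < 0
  a02 : a 0 * a 2 < 0
  b01 : b 0 * b 1 < 0
  b02 : b 0 * b 2 < 0
  lt01 : (b 1 * a 0) ^ 2 < (b 0 * a 1) ^ 2
  lt12 : (b 2 * a 1) ^ 2 < (b 1 * a 2) ^ 2

/-- The difference of squares factors: `h` gives the sign of `b₀ * a₁ - b₁ * a₀`, and the two
summands of `b₀ * a₁ + b₁ * a₀` have the same sign. -/
theorem sq_lt_sq_of_signs {a₀ a₁ b₀ b₁ b₂ : ℝ} (ha : a₀ * a₁ < 0) (hb : b₀ * b₁ < 0)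
    (h12 : 0 < b₁ * b₂) (h : 0 < a₀ * (b₁ * a₀ - b₀ * a₁) * (b₀ * b₁ * b₂)) :
    (b₁ * a₀) ^ 2 < (b₀ * a₁) ^ 2 := by
  have ha0 : 0 < a₀ ^ 2 := sq_pos_of_ne_zero (left_ne_zero_of_mul ha.ne)
  have hb0 : 0 < b₀ ^ 2 := sq_pos_of_ne_zero (left_ne_zero_of_mul hb.ne)
  have hX : 0 < -(a₀ * b₀) * (b₀ * a₁ - b₁ * a₀) := by
    refine pos_of_mul_pos_left (b := b₁ * b₂) ?_ h12.le
    linarith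
  have hY : 0 < -(a₀ * b₀) * (b₀ * a₁ + b₁ * a₀) := by
    have := mul_pos (neg_pos.2 ha) hb0
    have := mul_pos (neg_pos.2 hb) ha0
    linarith
  have hXY : 0 < ((b₀ * a₁) ^ 2 - (b₁ * a₀) ^ 2) * (a₀ ^ 2 * b₀ ^ 2) := by
    have := mul_pos hX hY
    linarith
  linarith [pos_of_mul_pos_left hXY (mul_pos ha0 hb0).le]

theorem signs_of_pos {a₀ a₁ a₂ b₀ b₁ b₂ : ℝ} (ha₁ : a₀ * a₁ < 0) (ha₂ : a₀ * a₂ < 0)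
    (hb : b₀ * b₁ * b₂ ≠ 0) (hdef : ¬ (0 < b₀ * b₁ ∧ 0 < b₀ * b₂))
    (h₁ : 0 < a₀ * (b₁ * a₀ - b₀ * a₁) * (b₀ * b₁ * b₂))
    (h₂ : 0 < a₀ * (b₂ * a₀ - b₀ * a₂) * (b₀ * b₁ * b₂)) :
    b₀ * b₁ < 0 ∧ b₀ * b₂ < 0 ∧ 0 < b₁ * b₂ := by
  have hb2 : b₂ ≠ 0 := right_ne_zero_of_mul hb
  have hb1 : b₁ ≠ 0 := right_ne_zero_of_mul (left_ne_zero_of_mul hb)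
  have hb0 : b₀ ≠ 0 := left_ne_zero_of_mul (left_ne_zero_of_mul hb)
  have ha0 : 0 < a₀ ^ 2 := sq_pos_of_ne_zero (left_ne_zero_of_mul ha₁.ne)
  have hb0' := sq_pos_of_ne_zero hb0
  have hb1' := sq_pos_of_ne_zero hb1
  have hb2' := sq_pos_of_ne_zero hb2
  have h12 : 0 < b₁ * b₂ := by
    -- If `b₁ * b₂ ≤ 0`, the terms of `h₁` and `h₂` containing `b₀²` are nonpositive. The others
    -- force `b₁` and `b₂` both to have the sign of `b₀ * b₁ * b₂`, a contradiction.
    by_contra! hle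
    have hneg := mul_nonneg hb0'.le (neg_nonneg.2 hle)
    have k1 : 0 < b₁ * (b₀ * b₁ * b₂) := by
      refine pos_of_mul_pos_right (a := a₀ ^ 2) ?_ ha0.le
      have := mul_nonneg hneg (neg_nonneg.2 ha₁.le)
      linarith
    have k2 : 0 < b₂ * (b₀ * b₁ * b₂) := by
      refine pos_of_mul_pos_right (a := a₀ ^ 2) ?_ ha0.le
      have := mul_nonneg hneg (neg_nonneg.2 ha₂.le)
      linarith
    have k12 : 0 < (b₁ * b₂) * (b₀ * b₁ * b₂) ^ 2 := by
      have := mul_pos k1 k2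
      linarith
    exact absurd (pos_of_mul_pos_left k12 (sq_nonneg _)) (not_lt.2 hle)
  have h01 : b₀ * b₁ < 0 := by
    refine lt_of_le_of_ne (not_lt.1 fun h ↦ hdef ⟨h, ?_⟩) (mul_ne_zero hb0 hb1)
    refine pos_of_mul_pos_left (b := b₁ ^ 2) ?_ hb1'.le
    have := mul_pos h h12
    linarith
  refine ⟨h01, ?_, h12⟩
  have : 0 < -(b₀ * b₂) := by
    refine pos_of_mul_pos_left (b := b₁ ^ 2) ?_ hb1'.le
    have := mul_pos (neg_pos.2 h01) h12
    linarith
  linarith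

theorem IsDiagonalization.exists_isOrdered {f g : TernaryForm} {P : Matrix (Fin 3) (Fin 3) ℝ}
    {a b : Fin 3 → ℝ} (h : IsDiagonalization f g P a b) (hdf : disc f ≠ 0) (hdg : disc g ≠ 0)
    (hf : (zeroLocus f).Nonempty) (hg : (zeroLocus g).Nonempty) (hfg : LiesInside f g) :
    ∃ P a b, IsDiagonalization f g P a b ∧ IsOrdered a b := by
  -- As `f` is indefinite, one coordinate has sign opposite to the other two; a permutation moves it
  -- to index `0`.
  obtain ⟨P, a, b, h, h1, h2⟩ : ∃ P a b, IsDiagonalization f g P a b ∧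
      a 0 * a 1 < 0 ∧ a 0 * a 2 < 0 := by
    have hnd := h.not_definite hf
    rw [disc_eq_of_toMatrix' h.left] at hdf
    have ha := right_ne_zero_of_mul hdf
    have h0 := left_ne_zero_of_mul (left_ne_zero_of_mul ha)
    have h1 := right_ne_zero_of_mul (left_ne_zero_of_mul ha)
    have h2 := right_ne_zero_of_mul ha
    have h0' := sq_pos_of_ne_zero h0
    rcases lt_or_gt_of_ne (mul_ne_zero h0 h1) with h01 | h01 <;>
      rcases lt_or_gt_of_ne (mul_ne_zero h0 h2) with h02 | h02
    · exact ⟨_, _, _, h, h01, h02⟩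
    · refine ⟨_, _, _, h.perm (Equiv.swap 0 1), ?_, ?_⟩
      · simpa [mul_comm] using h01
      · have : Equiv.swap (0 : Fin 3) 1 2 = 2 := by decide
        simp only [Function.comp, Equiv.swap_apply_left, this]
        have := mul_pos (neg_pos.2 h01) h02
        have : 0 < -(a 1 * a 2) := pos_of_mul_pos_left (b := a 0 ^ 2) (by linarith) h0'.le
        linarith
    · refine ⟨_, _, _, h.perm (Equiv.swap 0 2), ?_, ?_⟩
      · have : Equiv.swap (0 : Fin 3) 2 1 = 1 := by decide
        simp only [Function.comp, Equiv.swap_apply_left, this]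
        have := mul_pos (neg_pos.2 h02) h01
        have : 0 < -(a 2 * a 1) := pos_of_mul_pos_left (b := a 0 ^ 2) (by linarith) h0'.le
        linarith
      · simpa [mul_comm] using h02
    · exact absurd ⟨h01, h02⟩ hnd
  have hb : b 0 * b 1 * b 2 ≠ 0 := by
    rw [disc_eq_of_toMatrix' h.right] at hdg
    exact right_ne_zero_of_mul hdg
  have p1 := h.pos_of_liesInside hb hfg (i := 0) (j := 1) (by decide) h1
  have p2 := h.pos_of_liesInside hb hfg (i := 0) (j := 2) (by decide) h2
  obtain ⟨b01, b02, b12⟩ := signs_of_pos h1 h2 hb (h.swap.not_definite hg) p1 p2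
  have l1 := sq_lt_sq_of_signs h1 b01 b12 p1
  have l2 := sq_lt_sq_of_signs h2 b02 (b₂ := b 1) (by linarith) (by linarith)
  have a12 : 0 < a 1 * a 2 := by
    refine pos_of_mul_pos_left (b := a 0 ^ 2) ?_ (sq_nonneg _)
    have := mul_pos_of_neg_of_neg h1 h2
    linarith
  have hne : (b 2 * a 1) ^ 2 ≠ (b 1 * a 2) ^ 2 := by
    intro heq
    rcases sq_eq_sq_iff_eq_or_eq_neg.1 heq with h3 | h3
    · exact h.ne 1 2 (by decide) (by linarith)
    · have k := mul_pos a12 b12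
      have : (b 2 * a 1) * (b 1 * a 2) ≤ 0 := by rw [h3]; nlinarith [sq_nonneg (b 1 * a 2)]
      linarith
  rcases lt_or_gt_of_ne hne with h3 | h3
  · exact ⟨P, a, b, h, h1, h2, b01, b02, l1, h3⟩
  · have e0 : Equiv.swap (1 : Fin 3) 2 0 = 0 := by decide
    refine ⟨_, _, _, h.perm (Equiv.swap 1 2), ?_, ?_, ?_, ?_, ?_, ?_⟩ <;>
      simpa [e0]

/-! ### Signs of the weights -/

/-- The ratios `bᵢ / aᵢ` have the same sign and decrease in absolute value. -/
structure DecreasingRatios (a b : Fin 3 → ℝ) : Prop where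
  pos01 : 0 < a 0 * a 1 * (b 0 * b 1)
  pos12 : 0 < a 1 * a 2 * (b 1 * b 2)
  lt01 : (b 1 * a 0) ^ 2 < (b 0 * a 1) ^ 2
  lt12 : (b 2 * a 1) ^ 2 < (b 1 * a 2) ^ 2

theorem mul_pos_of_mul_neg {x y z : ℝ} (hxy : x * y < 0) (hxz : x * z < 0) : 0 < y * z := by
  refine pos_of_mul_pos_left (b := x ^ 2) ?_ (sq_nonneg _)
  have := mul_pos_of_neg_of_neg hxy hxz
  linarith

theorem IsOrdered.decreasingRatios {a b : Fin 3 → ℝ} (h : IsOrdered a b) :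
    DecreasingRatios a b where
  pos01 := mul_pos_of_neg_of_neg h.a01 h.b01
  pos12 := mul_pos (mul_pos_of_mul_neg h.a01 h.a02) (mul_pos_of_mul_neg h.b01 h.b02)
  lt01 := h.lt01
  lt12 := h.lt12

/-- Inverting the ratios reverses their order, so the odd coordinate goes from index `0` to index
`2`. -/
theorem IsOrdered.decreasingRatios_swap {a b : Fin 3 → ℝ} (h : IsOrdered b a) :
    DecreasingRatios (a ∘ Equiv.swap 0 2) (b ∘ Equiv.swap 0 2) := by
  have e1 : Equiv.swap (0 : Fin 3) 2 1 = 1 := by decide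
  obtain ⟨h1, h2, h3, h4⟩ := h.decreasingRatios
  constructor <;> simp only [Function.comp, Equiv.swap_apply_left, Equiv.swap_apply_right, e1] <;>
    linarith

/-- Signs of the barycentric weights, when the roots `x, y, z` have the same sign and decrease in
absolute value. -/
theorem weight_signs {x y z : ℝ} (hxy : 0 < x * y) (hyz : 0 < y * z) (h1 : y ^ 2 < x ^ 2)
    (h2 : z ^ 2 < y ^ 2) :
    0 < x * y * z * (3 * x - (x + y + z)) * ((x - y) * (x - z)) ∧
    0 < -(x * y * z * (3 * z - (x + y + z)) * ((z - x) * (z - y))) ∧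
    (∃ p, 0 < p ∧ x * y * z * (3 * y - (x + y + z)) * ((y - x) * (y - z)) =
      p * (x * y * z * ((3 * x - (x + y + z)) * (3 * y - (x + y + z)) *
        (3 * z - (x + y + z))))) := by
  -- All the expressions are homogeneous of degree `6`, hence unchanged when the three roots change
  -- sign.
  wlog hx : 0 < x generalizing x y z
  · have hx0 : x ≠ 0 := left_ne_zero_of_mul hxy.ne'
    have hx' : 0 < -x := by
      have := lt_of_le_of_ne (not_lt.1 hx) hx0
      linarith
    obtain ⟨k1, k2, p, hp, k3⟩ := this (x := -x) (y := -y) (z := -z) (by linarith) (by linarith)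
      (by linarith) (by linarith) hx'
    exact ⟨by linarith, by linarith, p, hp, by linarith⟩
  have hy : 0 < y := pos_of_mul_pos_right hxy hx.le
  have hz : 0 < z := pos_of_mul_pos_right hyz hy.le
  have hyx : 0 < x - y := sub_pos.2 (lt_of_pow_lt_pow_left₀ 2 hx.le h1)
  have hzy : 0 < y - z := sub_pos.2 (lt_of_pow_lt_pow_left₀ 2 hy.le h2)
  have hzx : 0 < x - z := by linarith
  have hX : 0 < 3 * x - (x + y + z) := by linarith
  have hZ : 0 < -(3 * z - (x + y + z)) := by linarith
  refine ⟨by positivity, ?_, (x - y) * (y - z) / ((3 * x - (x + y + z)) *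
    -(3 * z - (x + y + z))), by positivity, ?_⟩
  · have : 0 < x * y * z * -(3 * z - (x + y + z)) * ((x - z) * (y - z)) := by positivity
    linarith
  · have := hX.ne'
    have := hZ.ne'
    rw [div_mul_eq_mul_div, eq_div_iff (mul_ne_zero hX.ne' hZ.ne')]
    ring

/-- The invariants of the pencil in terms of quantities `u`, `v`, `w` of known signs. -/
theorem IsDiagonalization.exists_weights {f g : TernaryForm} {P : Matrix (Fin 3) (Fin 3) ℝ}
    {a b : Fin 3 → ℝ} (h : IsDiagonalization f g P a b) (hab : DecreasingRatios a b)
    (h02 : a 0 * a 2 < 0) :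
    ∃ x y z u v w p q : ℝ, x ≠ y ∧ y ≠ z ∧ 0 < p ∧ 0 < q ∧ 0 < -(u * (a 1 * a 2)) ∧
      v = q * (Phi03 f g * R f g) ∧ 0 < w * (a 0 * a 1) ∧ Phi03 f g * q2 f g = u + v + w ∧
      Phi30 f g * B1 f g = p *
        (u * v * (x - y) ^ 2 + u * w * (x - z) ^ 2 + v * w * (y - z) ^ 2) := by
  have h0 : a 0 ≠ 0 := left_ne_zero_of_mul h02.ne
  have h2 : a 2 ≠ 0 := right_ne_zero_of_mul h02.ne
  have h1 : a 1 ≠ 0 := left_ne_zero_of_mul (left_ne_zero_of_mul hab.pos12.ne')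
  have hd : 0 < P.det ^ 2 := sq_pos_of_ne_zero h.det_ne
  obtain ⟨x, hx⟩ : ∃ x, b 0 = -(a 0 * x) := ⟨-(b 0 / a 0), by field_simp⟩
  obtain ⟨y, hy⟩ : ∃ y, b 1 = -(a 1 * y) := ⟨-(b 1 / a 1), by field_simp⟩
  obtain ⟨z, hz⟩ : ∃ z, b 2 = -(a 2 * z) := ⟨-(b 2 / a 2), by field_simp⟩
  obtain ⟨p01, p12, l01, l12⟩ := hab
  rw [hx, hy] at p01 l01
  rw [hy, hz] at p12 l12
  have hxy : 0 < x * y :=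
    pos_of_mul_pos_right (a := (a 0 * a 1) ^ 2) (by linarith) (sq_nonneg _)
  have hyz : 0 < y * z :=
    pos_of_mul_pos_right (a := (a 1 * a 2) ^ 2) (by linarith) (sq_nonneg _)
  have lxy : y ^ 2 < x ^ 2 :=
    lt_of_mul_lt_mul_left (a := (a 0 * a 1) ^ 2) (by linarith) (sq_nonneg _)
  have lyz : z ^ 2 < y ^ 2 :=
    lt_of_mul_lt_mul_left (a := (a 1 * a 2) ^ 2) (by linarith) (sq_nonneg _)
  have nxy : x ≠ y := by rintro rfl; exact lxy.false
  have nyz : y ≠ z := by rintro rfl; exact lyz.false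
  have nxz : x ≠ z := by rintro rfl; exact (lxy.trans lyz).false
  set c : ℝ := P.det ^ 2 * (a 0 * a 1 * a 2) with hc
  have hc0 : c ≠ 0 := mul_ne_zero hd.ne' (mul_ne_zero (mul_ne_zero h0 h1) h2)
  have hphi : phi f g = C c * ((X - C x) * (X - C y) * (X - C z)) := by
    rw [h.phi_eq, hx, hy, hz, hc]; simp; ring
  have h03 : Phi03 f g = -c * (x * y * z) := (coeff_cubic hphi).2.2.2
  have hR := R_cubic hc0 hphi
  obtain ⟨e2, eB⟩ := Q_cubic hc0 nxy nxz nyz hphi rfl rfl rfl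
  rw [h.eval_psi, h.eval_psi, h.eval_psi, hx, hy, hz] at e2 eB
  obtain ⟨s0, s2, r, hr, s1⟩ := weight_signs hxy hyz lxy lyz
  have n0 := cofactorNorm_pos h.det_ne 0
  have n1 := cofactorNorm_pos h.det_ne 1
  have n2 := cofactorNorm_pos h.det_ne 2
  have hc4 : 0 < c ^ 4 := by positivity
  have hsq : 0 < (x * y * z) ^ 2 := by
    have : y ≠ 0 := right_ne_zero_of_mul hxy.ne'
    have : x ≠ 0 := left_ne_zero_of_mul hxy.ne'
    have : z ≠ 0 := right_ne_zero_of_mul hyz.ne'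
    positivity
  have a12 : 0 < (a 1 * a 2) ^ 2 := by positivity
  have a01 : 0 < (a 0 * a 1) ^ 2 := by positivity
  have hq : 0 < cofactorNorm P 1 * r * -(a 0 * a 2) := by
    have : 0 < -(a 0 * a 2) := by linarith
    positivity
  -- These are the weights of `Q_cubic` multiplied by `Φ₀₃ = -c * (x * y * z)`; `Φ₀₃²` in the
  -- quadratic expression accounts for `p`.
  refine ⟨x, y, z,
    -c ^ 4 * cofactorNorm P 0 * (a 1 * a 2) *
      (x * y * z * (3 * x - (x + y + z)) * ((x - y) * (x - z))),
    -c ^ 4 * cofactorNorm P 1 * (a 0 * a 2) *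
      (x * y * z * (3 * y - (x + y + z)) * ((y - x) * (y - z))),
    -c ^ 4 * cofactorNorm P 2 * (a 0 * a 1) *
      (x * y * z * (3 * z - (x + y + z)) * ((z - x) * (z - y))),
    1 / (x * y * z) ^ 2, cofactorNorm P 1 * r * -(a 0 * a 2), nxy, nyz, by positivity, hq,
    ?_, ?_, ?_, ?_, ?_⟩
  · have := mul_pos (mul_pos (mul_pos hc4 n0) a12) s0
    linarith
  · rw [s1, h03, hR]; ring
  · have := mul_pos (mul_pos (mul_pos hc4 n2) a01) s2
    linarith
  · rw [h03, e2]; ring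
  · rw [eB, one_div, eq_inv_mul_iff_mul_eq₀ hsq.ne']; ring

/-! ### Deciding which conic lies inside -/

/-- The relation between the first two leading minors of a `3`-point moment matrix. -/
theorem minor_identity (x y z u v w : ℝ) :
    u * v * (x - y) ^ 2 + u * w * (x - z) ^ 2 + v * w * (y - z) ^ 2 =
      (u + v + w) * (u * (x - y) ^ 2 + w * (z - y) ^ 2) - (u * (x - y) + w * (z - y)) ^ 2 := by
  ring

/-- Here `u` and `w` are negative: the moment matrix is negative definite when `v < 0` and is never
positive definite. -/
theorem conditions_of_isOrdered {f g : TernaryForm}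
    (h : ∃ P a b, IsDiagonalization f g P a b ∧ IsOrdered a b) :
    (Phi03 f g * R f g < 0 → Phi30 f g * B1 f g > 0 ∧ Phi03 f g * q2 f g < 0) ∧
    (Phi03 f g * R f g > 0 → Phi30 f g * B1 f g ≤ 0 ∨ Phi03 f g * q2 f g ≤ 0) ∧
    (R f g = 0 → Phi03 f g * q2 f g < 0) := by
  obtain ⟨P, a, b, h, hab⟩ := h
  obtain ⟨x, y, z, u, v, w, p, q, hxy, hyz, hp, hq, hu, hv, hw, e2, eB⟩ :=
    h.exists_weights hab.decreasingRatios hab.a02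
  have a12 := mul_pos_of_mul_neg hab.a01 hab.a02
  have hu : u < 0 := by
    have := pos_of_mul_pos_left (a := -u) (b := a 1 * a 2) (by linarith) a12.le
    linarith
  have hw : w < 0 := by
    have := pos_of_mul_pos_left (a := -w) (b := -(a 0 * a 1)) (by linarith) (by linarith [hab.a01])
    linarith
  have sxy : 0 < (x - y) ^ 2 := sq_pos_of_ne_zero (sub_ne_zero.2 hxy)
  have syz : 0 < (y - z) ^ 2 := sq_pos_of_ne_zero (sub_ne_zero.2 hyz)
  rw [e2, eB]
  refine ⟨fun hR ↦ ?_, fun hR ↦ ?_, fun hR ↦ ?_⟩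
  · have hv : v < 0 := hv ▸ mul_neg_of_pos_of_neg hq hR
    have k1 := mul_pos (mul_pos_of_neg_of_neg hu hv) sxy
    have k2 := mul_pos (mul_pos_of_neg_of_neg hv hw) syz
    have k3 := mul_nonneg (mul_pos_of_neg_of_neg hu hw).le (sq_nonneg (x - z))
    exact ⟨mul_pos hp (by linarith), by linarith⟩
  · by_contra! hc
    obtain ⟨h1, h2⟩ := hc
    have h1 := pos_of_mul_pos_right h1 hp.le
    -- A positive determinant and a positive `u + v + w` would force the centred second moment to be
    -- positive, but it involves only `u, w < 0`.
    rw [minor_identity] at h1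
    have k1 := mul_neg_of_neg_of_pos hu sxy
    have k2 := mul_nonneg_of_nonpos_of_nonpos hw.le (neg_nonpos.2 (sq_nonneg (z - y)))
    have k3 := mul_neg_of_pos_of_neg h2
      (show u * (x - y) ^ 2 + w * (z - y) ^ 2 < 0 by linarith)
    linarith [sq_nonneg (u * (x - y) + w * (z - y))]
  · rw [hR] at hv
    linarith

/-- The mirror case, with `u` and `w` positive: the moment matrix is positive definite when `v > 0`
and is never negative definite. -/
theorem not_conditions_of_isOrdered {f g : TernaryForm}
    (h : ∃ P b a, IsDiagonalization g f P b a ∧ IsOrdered b a) :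
    (Phi03 f g * R f g < 0 → ¬ (Phi30 f g * B1 f g > 0 ∧ Phi03 f g * q2 f g < 0)) ∧
    (Phi03 f g * R f g > 0 → ¬ (Phi30 f g * B1 f g ≤ 0 ∨ Phi03 f g * q2 f g ≤ 0)) ∧
    (R f g = 0 → ¬ Phi03 f g * q2 f g < 0) := by
  obtain ⟨P, b, a, h, hab⟩ := h
  have e1 : Equiv.swap (0 : Fin 3) 2 1 = 1 := by decide
  obtain ⟨x, y, z, u, v, w, p, q, hxy, hyz, hp, hq, hu, hv, hw, e2, eB⟩ :=
    (h.swap.perm (Equiv.swap 0 2)).exists_weights hab.decreasingRatios_swap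
      (by simpa [mul_comm] using hab.b02)
  simp only [Function.comp, Equiv.swap_apply_left, Equiv.swap_apply_right, e1] at hu hw
  have a12 := mul_pos_of_mul_neg hab.b01 hab.b02
  have hu : 0 < u := pos_of_mul_pos_left (b := -(a 0 * a 1)) (by linarith) (by linarith [hab.b01])
  have hw : 0 < w := pos_of_mul_pos_left (b := a 1 * a 2) (by linarith) a12.le
  have sxy : 0 < (x - y) ^ 2 := sq_pos_of_ne_zero (sub_ne_zero.2 hxy)
  have syz : 0 < (y - z) ^ 2 := sq_pos_of_ne_zero (sub_ne_zero.2 hyz)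
  rw [e2, eB]
  refine ⟨fun hR ↦ ?_, fun hR ↦ ?_, fun hR ↦ ?_⟩
  · rintro ⟨h1, h2⟩
    have h1 := pos_of_mul_pos_right h1 hp.le
    rw [minor_identity] at h1
    have k1 := mul_pos hu sxy
    have k2 := mul_nonneg hw.le (sq_nonneg (z - y))
    have k3 := mul_neg_of_neg_of_pos h2
      (show 0 < u * (x - y) ^ 2 + w * (z - y) ^ 2 by linarith)
    linarith [sq_nonneg (u * (x - y) + w * (z - y))]
  · have hv : 0 < v := hv ▸ mul_pos hq hR
    have k1 := mul_pos (mul_pos hu hv) sxy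
    have k2 := mul_pos (mul_pos hv hw) syz
    have k3 := mul_nonneg (mul_pos hu hw).le (sq_nonneg (x - z))
    push Not
    exact ⟨mul_pos hp (by linarith), by linarith⟩
  · rw [hR] at hv
    linarith

end PencilConics

end

theorem mainTheorem12 (f g : PencilConics.TernaryForm)
    (hf : PencilConics.disc f ≠ 0) (hg : PencilConics.disc g ≠ 0)
    (hIa : PencilConics.GeneratesOrbitIa f g) (hN : PencilConics.Nested f g) :
    (PencilConics.Phi03 f g * PencilConics.R f g < 0 →
      (PencilConics.LiesInside f g ↔
        PencilConics.Phi30 f g * PencilConics.B1 f g > 0 ∧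
          PencilConics.Phi03 f g * PencilConics.q2 f g < 0)) ∧
    (PencilConics.Phi03 f g * PencilConics.R f g > 0 →
      (PencilConics.LiesInside f g ↔
        PencilConics.Phi30 f g * PencilConics.B1 f g ≤ 0 ∨
          PencilConics.Phi03 f g * PencilConics.q2 f g ≤ 0)) ∧
    (PencilConics.R f g = 0 →
      (PencilConics.LiesInside f g ↔
        PencilConics.Phi03 f g * PencilConics.q2 f g < 0)) := by
  obtain ⟨P, a, b, h⟩ := hIa.exists_isDiagonalization
  obtain ⟨hf0, hg0, hfg⟩ := hN
  have hyes := fun hi : PencilConics.LiesInside f g ↦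
    PencilConics.conditions_of_isOrdered (h.exists_isOrdered hf hg hf0 hg0 hi)
  have hno := fun hi : PencilConics.LiesInside g f ↦
    PencilConics.not_conditions_of_isOrdered (h.swap.exists_isOrdered hg hf hg0 hf0 hi)
  refine ⟨fun hR ↦ ⟨fun hi ↦ (hyes hi).1 hR, fun hc ↦ ?_⟩,
    fun hR ↦ ⟨fun hi ↦ (hyes hi).2.1 hR, fun hc ↦ ?_⟩,
    fun hR ↦ ⟨fun hi ↦ (hyes hi).2.2 hR, fun hc ↦ ?_⟩⟩
  · exact hfg.resolve_right fun hi ↦ (hno hi).1 hR hc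
  · exact hfg.resolve_right fun hi ↦ (hno hi).2.1 hR hc
  · exact hfg.resolve_right fun hi ↦ (hno hi).2.2 hR hc
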